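/- Let $(X,\tau)$ be an uncountable Polish space and let $1\le\xi<\omega_1$. **Conventions.** Baire class $0$ functions are the continuous functions $X\to\mathbb R$, and $f$ is of Baire class $\xi>0$ if it is the pointwise limit of functions $f_n$ of Baire class $\xi_n<\xi$; $\mathcal B_\xi(\tau')$ is the family of Baire class $\xi$ functions with respect to a topology $\tau'$, and $\mathcal B_\xi=\mathcal B_\xi(\tau)$. $\boldsymbol\Sigma^0_\xi(\tau)$ is the $\xi$th additive Borel class. A set is perfect if it is closed and has no isolated points, and $\chi_A$ is the characteristic function of $A$. For a map $D$ on the closed subsets of $X$ (with respect to a topology $\tau'$) put $D^0(F)=F$, $D^{\eta+1}(F)=D(D^\eta(F))$ and $D^\eta(F)=\bigcap_{\theta<\eta}D^\theta(F)$ for limit $\eta$. Let $\mathrm{rk}(D)$ be the least $\eta$ with $D^\eta(X)=\emptyset$ if there is one, and $\omega_1$ otherwise. For a Polish topology $\tau'$ on $X$ and $f\in\mathcal B_1(\tau')$ define, all topological notions being those of $\tau'$, * $\alpha_{\tau'}(f)=\sup_{p<q,\ p,q\in\mathbb Q}\mathrm{rk}(D_{\{f\le p\},\{f\ge q\}})$,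 where $D_{A,B}(F)=\overline{F\cap A}\cap\overline{F\cap B}$; * $\beta_{\tau'}(f)=\sup_{\varepsilon>0}\mathrm{rk}(D_{f,\varepsilon})$, where $D_{f,\varepsilon}(F)=\{x\in F:\omega(f,x,F)\ge\varepsilon\}$ and $\omega(f,x,F)=\inf_{U\ni x\text{ open}}\ \sup_{x_1,x_2\in U\cap F}|f(x_1)-f(x_2)|$; * $\gamma_{\tau'}(f)=\min\sup_{\varepsilon>0}\mathrm{rk}(D_{(f_n),\varepsilon})$, where the minimum is over all sequences $(f_n)$ of continuous functions converging pointwise to $f$, $D_{(f_n),\varepsilon}(F)=\{x\in F:\omega((f_n),x,F)\ge\varepsilon\}$ and $\omega((f_n),x,F)=\inf_{U\ni x\text{ open}}\ \inf_{N}\ \sup\{|f_m(y)-f_n(y)|:n,m\ge N,\ y\in U\cap F\}$. For $f\in\mathcal B_\xi$ let $T_{f,\xi}$ be the set of Polish topologies $\tau'\supseteq\tau$ on $X$ with $\tau'\subseteq\boldsymbol\Sigma^0_\xi(\tau)$ and $f\in\mathcal B_1(\tau')$, and for $\rho\in\{\alpha,\beta,\gamma\}$ let $\rho^*_\xi(f)=\min_{\tau'\in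 T_{f,\xi}}\rho_{\tau'}(f)$. **Theorem.** The ranks $\alpha^*_\xi$, $\beta^*_\xi$ and $\gamma^*_\xi$ are unbounded in $\omega_1$: for each $\rho\in\{\alpha,\beta,\gamma\}$ and each $\zeta<\omega_1$ there is $f\in\mathcal B_\xi$ with $\zeta\le\rho^*_\xi(f)<\omega_1$. Moreover, for every non-empty perfect set $P\subseteq X$ and every ordinal $\zeta<\omega_1$ there is a set $A\subseteq P$ with $\chi_A\in\mathcal B_\xi$ such that each of $\alpha^*_\xi(\chi_A)$, $\beta^*_\xi(\chi_A)$, $\gamma^*_\xi(\chi_A)$ is at least $\zeta$ and less than $\omega_1$. -/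

import Mathlib

open Set Filter Topology Ordinal

namespace BaireRank

/-- The additive classes `Σ⁰_ξ(τ)` of the Borel hierarchy (`1 ≤ ξ`): `Σ⁰_1` consists of the open
sets and, for `ξ > 1`, `Σ⁰_ξ` consists of the countable unions of sets whose complements belong to
classes `Σ⁰_η` with `1 ≤ η < ξ`. -/
inductive IsSigma {X : Type*} (τ : TopologicalSpace X) : Ordinal.{0} → Set X → Prop
  | isOpen (s : Set X) (hs : IsOpen[τ] s) : IsSigma τ 1 s
  | iUnion (ξ : Ordinal.{0}) (hξ : 1 < ξ) (η : ℕ → Ordinal.{0}) (hη : ∀ n, 1 ≤ η n ∧ η n < ξ)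
      (A : ℕ → Set X) (hA : ∀ n, IsSigma τ (η n) (A n)ᶜ) : IsSigma τ ξ (⋃ n, A n)

/-- `f` is of Baire class `ξ` with respect to `τ`: class `0` is the class of continuous functions
and the functions of class `ξ > 0` are the pointwise limits of sequences of functions of smaller
classes. -/
inductive IsBaireClass {X : Type*} (τ : TopologicalSpace X) : Ordinal.{0} → (X → ℝ) → Prop
  | continuous (f : X → ℝ) (hf : Continuous f) : IsBaireClass τ 0 f
  | limit (ξ : Ordinal.{0}) (η : ℕ → Ordinal.{0}) (hη : ∀ n, η n < ξ) (F : ℕ → X → ℝ)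
      (hF : ∀ n, IsBaireClass τ (η n) (F n)) (f : X → ℝ)
      (hf : ∀ x, Tendsto (fun n => F n x) atTop (𝓝 (f x))) : IsBaireClass τ ξ f

noncomputable section

/-- The iterated derivatives `D^η(F)`. -/
def iterDeriv {X : Type*} (D : Set X → Set X) (F : Set X) (η : Ordinal.{0}) : Set X :=
  Ordinal.limitRecOn η F (fun _ A => D A) (fun η _ A => ⋂ (θ : Ordinal.{0}) (h : θ < η), A θ h)

open Classical in
/-- The rank of a derivative: the least `η` with `D^η(X) = ∅` if there is one, and `ω₁` otherwise.
-/
def rk {X : Type*} (D : Set X → Set X) : Ordinal.{0} :=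
  if ∃ η, iterDeriv D univ η = ∅ then sInf {η | iterDeriv D univ η = ∅} else ω₁

/-- The derivative `D_{A,B}(F) = cl(F ∩ A) ∩ cl(F ∩ B)`. -/
def sepDeriv {X : Type*} (τ : TopologicalSpace X) (A B F : Set X) : Set X :=
  closure[τ] (F ∩ A) ∩ closure[τ] (F ∩ B)

/-- The separation rank `α(f)`, computed in the topology `τ`. -/
def alphaRank {X : Type*} (τ : TopologicalSpace X) (f : X → ℝ) : Ordinal.{0} :=
  ⨆ r : {r : ℚ × ℚ // r.1 < r.2},
    rk (sepDeriv τ {x | f x ≤ (r.1.1 : ℝ)} {x | (r.1.2 : ℝ) ≤ f x})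

/-- The oscillation `ω(f, x, F)`, with values in `[0, ∞]`. -/
def osc {X : Type*} (τ : TopologicalSpace X) (f : X → ℝ) (x : X) (F : Set X) : ENNReal :=
  ⨅ (U : Set X) (_ : IsOpen[τ] U) (_ : x ∈ U),
    ⨆ (x₁ ∈ U ∩ F) (x₂ ∈ U ∩ F), ENNReal.ofReal |f x₁ - f x₂|

/-- The derivative `D_{f,ε}(F) = {x ∈ F : ω(f, x, F) ≥ ε}`. -/
def oscDeriv {X : Type*} (τ : TopologicalSpace X) (f : X → ℝ) (ε : ℝ) (F : Set X) : Set X :=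
  {x | x ∈ F ∧ ENNReal.ofReal ε ≤ osc τ f x F}

/-- The oscillation rank `β(f)`, computed in the topology `τ`. -/
def betaRank {X : Type*} (τ : TopologicalSpace X) (f : X → ℝ) : Ordinal.{0} :=
  ⨆ ε : {ε : ℝ // 0 < ε}, rk (oscDeriv τ f ε.1)

/-- The oscillation `ω((f_n), x, F)` of a sequence of functions, with values in `[0, ∞]`. -/
def seqOsc {X : Type*} (τ : TopologicalSpace X) (f : ℕ → X → ℝ) (x : X) (F : Set X) : ENNReal :=
  ⨅ (U : Set X) (_ : IsOpen[τ] U) (_ : x ∈ U) (N : ℕ),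
    ⨆ (n : ℕ) (_ : N ≤ n) (m : ℕ) (_ : N ≤ m) (y ∈ U ∩ F), ENNReal.ofReal |f m y - f n y|

/-- The derivative `D_{(f_n),ε}(F) = {x ∈ F : ω((f_n), x, F) ≥ ε}`. -/
def seqDeriv {X : Type*} (τ : TopologicalSpace X) (f : ℕ → X → ℝ) (ε : ℝ) (F : Set X) : Set X :=
  {x | x ∈ F ∧ ENNReal.ofReal ε ≤ seqOsc τ f x F}

/-- The convergence rank `γ(f)`, computed in the topology `τ`: the minimum of
`sup_{ε > 0} rk(D_{(f_n),ε})` over all sequences of continuous functions `f_n → f` pointwise. -/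
def gammaRank {X : Type*} (τ : TopologicalSpace X) (f : X → ℝ) : Ordinal.{0} :=
  sInf {ρ | ∃ F : ℕ → X → ℝ, (∀ n, Continuous (F n)) ∧
    (∀ x, Tendsto (fun n => F n x) atTop (𝓝 (f x))) ∧
    ρ = ⨆ ε : {ε : ℝ // 0 < ε}, rk (seqDeriv τ F ε.1)}

/-- The set `T_{f,ξ}` of the Polish refinements `τ' ⊆ Σ⁰_ξ(τ)` of `τ` for which `f` is of Baire
class 1. In Mathlib's order `τ' ≤ τ` says that `τ'` is finer than `τ`. -/
def refinements {X : Type*} (τ : TopologicalSpace X) (ξ : Ordinal.{0}) (f : X → ℝ) :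
    Set (TopologicalSpace X) :=
  {τ' | τ' ≤ τ ∧ @PolishSpace X τ' ∧ (∀ U, IsOpen[τ'] U → IsSigma τ ξ U) ∧ IsBaireClass τ' 1 f}

/-- The rank `ρ*_ξ(f)`, the minimum of `ρ_{τ'}(f)` over `τ' ∈ T_{f,ξ}`, where `ρ τ' f` is the rank
of `f` computed in the topology `τ'`. -/
def starRank {X : Type*} (ρ : TopologicalSpace X → (X → ℝ) → Ordinal.{0}) (τ : TopologicalSpace X)
    (ξ : Ordinal.{0}) (f : X → ℝ) : Ordinal.{0} :=
  sInf ((fun τ' => ρ τ' f) '' refinements τ ξ f)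

end

end BaireRank

/-!
The lower bounds come from the strictness of the difference hierarchy over `Π⁰_ξ`. If `τ'` is a
Polish refinement contained in `Σ⁰_ξ(τ)` and the separation rank of `χ_A` in `τ'` is less than `ζ`,
then `Aᶜ` is a transfinite difference of length `ζ` of `τ'`-closed sets
(`exists_compl_eq_transDiff`), which are of class `Π⁰_ξ(τ)`. The latter description no longer
mentions `τ'`, so it suffices to diagonalize against all `ζ`-sequences of `Π⁰_ξ` sets at once: a
Cantor set `C ⊆ P` serves as the space of codes for such sequences, by means of universal `Σ⁰_ξ`
sets (`exists_universal`), and `A ⊆ C` is the transfinite difference of the diagonal sets `V η b`,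
where a point `x ∈ C` lies in `V η b` if it lies in the set of index `(η, b)` that it codes
(`exists_indicator_le_alphaRank`).

The diagonal sets are of class `Π⁰_ξ`, hence closed in a single Polish topology contained in `Σ⁰_ξ`
(`exists_polish_forall_isOpen`). In that topology `A` and `Aᶜ` are `F_σ`, so that `χ_A` is of Baire
class `1` there by Urysohn's lemma, and of Baire class `ξ` in the original topology
(`isBaireClass_indicator`).

For a function of Baire class `1` in a Polish topology `α ≤ β ≤ γ < ω₁`
(`alphaRank_le_betaRank`, `betaRank_le_gammaRank`, `gammaRank_lt`): the derivatives defining the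
smaller rank are contained in those defining the larger one, and by the Baire category theorem the
derivative of a convergent sequence of continuous functions shrinks every non-empty closed set. So
the lower bound for `α` and the upper bound for `γ` serve all three ranks. The assertion about
unbounded families of functions follows by taking for `P` any non-empty perfect subset of the
uncountable space.
-/

namespace BaireRank

/-! ### The additive Borel classes -/

section Sigma

variable {X : Type*}

theorem IsSigma.isOpen_of_one {τ : TopologicalSpace X} {S : Set X} (h : IsSigma τ 1 S) :
    IsOpen[τ] S := by
  generalize hξ : (1 : Ordinal.{0}) = ξ at h
  cases h with
  | isOpen s hs => exact hs
  | iUnion ξ h1 => exact absurd hξ h1.ne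

theorem isSigma_one {τ : TopologicalSpace X} {S : Set X} : IsSigma τ 1 S ↔ IsOpen[τ] S :=
  ⟨IsSigma.isOpen_of_one, IsSigma.isOpen S⟩

theorem IsSigma.exists_of_one_lt {τ : TopologicalSpace X} {ξ : Ordinal.{0}} {S : Set X}
    (h : IsSigma τ ξ S) (h1 : 1 < ξ) : ∃ (η : ℕ → Ordinal.{0}) (A : ℕ → Set X),
      (∀ n, 1 ≤ η n ∧ η n < ξ) ∧ (∀ n, IsSigma τ (η n) (A n)ᶜ) ∧ S = ⋃ n, A n := by
  cases h with
  | isOpen s hs => exact absurd rfl h1.ne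
  | iUnion ξ _ η hη A hA => exact ⟨η, A, hη, hA, rfl⟩

theorem IsSigma.one_le {τ : TopologicalSpace X} {ξ : Ordinal.{0}} {S : Set X}
    (h : IsSigma τ ξ S) : 1 ≤ ξ := by
  cases h with
  | isOpen s hs => exact le_rfl
  | iUnion ξ h => exact h.le

theorem IsSigma.compl_of_lt {τ : TopologicalSpace X} {η ξ : Ordinal.{0}} {S : Set X}
    (h : IsSigma τ η S) (hlt : η < ξ) : IsSigma τ ξ Sᶜ := by
  have := IsSigma.iUnion (τ := τ) ξ (h.one_le.trans_lt hlt) (fun _ => η)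
    (fun _ => ⟨h.one_le, hlt⟩) (fun _ => Sᶜ) (fun _ => by rwa [compl_compl])
  rwa [iUnion_const] at this

theorem IsSigma.iUnion_nat {τ : TopologicalSpace X} {ξ : Ordinal.{0}} {S : ℕ → Set X}
    (h : ∀ n, IsSigma τ ξ (S n)) : IsSigma τ ξ (⋃ n, S n) := by
  rcases (h 0).one_le.eq_or_lt with rfl | h1
  · exact isSigma_one.2 (isOpen_iUnion fun n => (h n).isOpen_of_one)
  · choose η A hη hA hS using fun n => (h n).exists_of_one_lt h1
    have := IsSigma.iUnion (τ := τ) ξ h1 (fun k => η k.unpair.1 k.unpair.2) (fun k => hη _ _)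
      (fun k => A k.unpair.1 k.unpair.2) (fun k => hA _ _)
    rw [iUnion_unpair (fun i j => A i j)] at this
    rwa [iUnion_congr hS]

variable {τ : TopologicalSpace X}

theorem IsSigma.empty {ξ : Ordinal.{0}} (h : 1 ≤ ξ) : IsSigma τ ξ ∅ := by
  rcases h.eq_or_lt with rfl | h1
  · exact isSigma_one.2 isOpen_empty
  · simpa using (isSigma_one.2 (isOpen_univ (X := X))).compl_of_lt h1

theorem IsSigma.iUnion_countable {ι : Sort*} [Countable ι] {ξ : Ordinal.{0}} (hξ : 1 ≤ ξ)
    {S : ι → Set X} (h : ∀ n, IsSigma τ ξ (S n)) : IsSigma τ ξ (⋃ n, S n) := by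
  rcases isEmpty_or_nonempty ι with hι | hι
  · rw [iUnion_of_empty]
    exact IsSigma.empty hξ
  · obtain ⟨e, he⟩ := exists_surjective_nat ι
    rw [← he.iUnion_comp]
    exact IsSigma.iUnion_nat fun n => h _

theorem IsSigma.union {ξ : Ordinal.{0}} {S T : Set X} (hS : IsSigma τ ξ S)
    (hT : IsSigma τ ξ T) : IsSigma τ ξ (S ∪ T) := by
  rw [union_eq_iUnion]
  exact IsSigma.iUnion_countable hS.one_le (by rintro (_ | _) <;> assumption)

variable [PolishSpace X]

theorem IsSigma.mono {η ξ : Ordinal.{0}} {S : Set X} (h : IsSigma τ η S) (hle : η ≤ ξ) :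
    IsSigma τ ξ S := by
  rcases hle.eq_or_lt with rfl | hlt
  · exact h
  rcases h.one_le.eq_or_lt with rfl | h1
  · let := TopologicalSpace.upgradeIsCompletelyMetrizable X
    obtain ⟨F, hF, -, hU, -⟩ := h.isOpen_of_one.exists_iUnion_isClosed
    rw [← hU]
    exact IsSigma.iUnion ξ hlt (fun _ => 1) (fun _ => ⟨le_rfl, hlt⟩) F
      fun n => isSigma_one.2 (hF n).isOpen_compl
  · obtain ⟨η', A, hη, hA, rfl⟩ := h.exists_of_one_lt h1
    exact IsSigma.iUnion ξ (h1.trans hlt) η' (fun n => ⟨(hη n).1, (hη n).2.trans hlt⟩) A hA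

theorem IsSigma.of_isOpen {ξ : Ordinal.{0}} (hξ : 1 ≤ ξ) {S : Set X} (h : IsOpen S) :
    IsSigma τ ξ S :=
  (isSigma_one.2 h).mono hξ

theorem IsSigma.inter {ξ : Ordinal.{0}} {S T : Set X} (hS : IsSigma τ ξ S)
    (hT : IsSigma τ ξ T) : IsSigma τ ξ (S ∩ T) := by
  rcases hS.one_le.eq_or_lt with rfl | h1
  · exact isSigma_one.2 (hS.isOpen_of_one.inter hT.isOpen_of_one)
  · obtain ⟨η, A, hη, hA, rfl⟩ := hS.exists_of_one_lt h1
    obtain ⟨θ, B, hθ, hB, rfl⟩ := hT.exists_of_one_lt h1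
    rw [iUnion_inter]
    refine IsSigma.iUnion_countable h1.le fun p => ?_
    rw [inter_iUnion]
    refine IsSigma.iUnion_countable h1.le fun q => ?_
    rw [← compl_compl (A p ∩ _), compl_inter]
    exact (((hA _).mono (le_max_left _ _)).union ((hB _).mono (le_max_right _ _))).compl_of_lt
      (max_lt (hη _).2 (hθ _).2)

theorem IsSigma.biInter_finset {ι : Type*} {ξ : Ordinal.{0}} (hξ : 1 ≤ ξ) (s : Finset ι)
    {S : ι → Set X} (h : ∀ i ∈ s, IsSigma τ ξ (S i)) : IsSigma τ ξ (⋂ i ∈ s, S i) := by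
  classical
  induction s using Finset.induction_on with
  | empty => simpa using IsSigma.of_isOpen hξ isOpen_univ
  | insert a s _ ih =>
    rw [Finset.set_biInter_insert]
    exact (h a (Finset.mem_insert_self a s)).inter
      (ih fun i hi => h i (Finset.mem_insert_of_mem hi))

end Sigma

/-! ### Polish refinements of controlled complexity -/

section Refinement

variable {X : Type*} [τ : TopologicalSpace X] [PolishSpace X]

/-- A closed set can be made open in a finer Polish topology whose open sets are
the sets `(V ∩ F) ∪ (W ∩ Fᶜ)` with `V` and `W` open. -/
theorem exists_polish_isClopen {F : Set X} (hF : IsClosed F) :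
    ∃ t : TopologicalSpace X, t ≤ τ ∧ @PolishSpace X t ∧ IsOpen[t] F ∧
      ∀ U, IsOpen[t] U → ∃ V W, IsOpen[τ] V ∧ IsOpen[τ] W ∧ U = V ∩ F ∪ W ∩ Fᶜ := by
  classical
  -- Transport to `X` the topology of the disjoint union of the Polish spaces `F` and `Fᶜ`.
  have : PolishSpace F := hF.polishSpace
  have : PolishSpace (Fᶜ : Set X) := hF.isOpen_compl.polishSpace
  let f : F ⊕ (Fᶜ : Set X) ≃ X := Equiv.Set.sumCompl F
  refine ⟨.coinduced f instTopologicalSpaceSum, ?_, ?_, ?_, ?_⟩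
  · simp only [instTopologicalSpaceSum, coinduced_sup, coinduced_compose, sup_le_iff,
      ← continuous_iff_coinduced_le]
    exact ⟨continuous_subtype_val, continuous_subtype_val⟩
  · rw [← f.induced_symm]
    exact f.symm.polishSpace_induced
  · rw [isOpen_coinduced, isOpen_sum_iff]
    simp [preimage_preimage, f]
  · intro U hU
    rw [isOpen_coinduced, isOpen_sum_iff, isOpen_induced_iff, isOpen_induced_iff] at hU
    obtain ⟨⟨V, hV, hVU⟩, W, hW, hWU⟩ := hU
    refine ⟨V, W, hV, hW, ?_⟩
    ext x
    by_cases hx : x ∈ F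
    · have := congrArg (fun s => (⟨x, hx⟩ : F) ∈ s) hVU
      simp [f] at this
      simp [hx, this]
    · have := congrArg (fun s => (⟨x, hx⟩ : (Fᶜ : Set X)) ∈ s) hWU
      simp [f] at this
      simp [hx, this]

/-- Countably many Polish refinements contained in `Σ⁰_ξ` have a common one: the topology they
generate has as a basis the finite intersections of their open sets. -/
theorem exists_polish_le_forall_isSigma {ξ : Ordinal.{0}} (hξ : 1 ≤ ξ)
    {ι : Type*} [Countable ι]
    (m : ι → TopologicalSpace X) (hm : ∀ n, m n ≤ τ) (hP : ∀ n, @PolishSpace X (m n))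
    (hS : ∀ n U, IsOpen[m n] U → IsSigma τ ξ U) :
    ∃ t : TopologicalSpace X, t ≤ τ ∧ (∀ n, t ≤ m n) ∧ @PolishSpace X t ∧
      ∀ U, IsOpen[t] U → IsSigma τ ξ U := by
  let m' : Option ι → TopologicalSpace X := fun i => i.elim τ m
  have hS' : ∀ n U, IsOpen[m' n] U → IsSigma τ ξ U := by
    rintro (_ | n) U hU
    exacts [IsSigma.of_isOpen hξ hU, hS n U hU]
  have hPt : @PolishSpace X (⨅ n, m' n) :=
    .iInf ⟨none, Option.forall.2 ⟨le_rfl, hm⟩⟩ <| Option.forall.2 ⟨‹_›, hP⟩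
  refine ⟨⨅ n, m' n, iInf_le m' none, fun i => iInf_le m' (some i), hPt, fun U hU => ?_⟩
  have hb := IsTopologicalBasis.iInf (t := m')
    (fun n => @TopologicalSpace.isTopologicalBasis_opens X (m' n))
  obtain ⟨S, hSb, rfl⟩ :=
    @TopologicalSpace.IsTopologicalBasis.open_eq_sUnion X (⨅ n, m' n) _ hb U hU
  obtain ⟨T, hT, hTS, hTU⟩ := @TopologicalSpace.isOpen_sUnion_countable X (⨅ n, m' n)
    hPt.toSecondCountableTopology S (fun s hs =>
      @TopologicalSpace.IsTopologicalBasis.isOpen X (⨅ n, m' n) _ _ hb (hSb hs))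
  rw [← hTU, sUnion_eq_iUnion]
  have := hT.to_subtype
  refine IsSigma.iUnion_countable hξ fun s => ?_
  obtain ⟨u, G, hu, hs⟩ := hSb (hTS s.2)
  rw [hs]
  exact IsSigma.biInter_finset hξ G fun i hi => hS' _ _ (hu i hi)

/-- A set of class `Σ⁰_η` can be made clopen at the cost of one level of the hierarchy. -/
theorem IsSigma.exists_polish_isClopen {η : Ordinal.{0}} {S : Set X} (h : IsSigma τ η S) :
    ∃ t : TopologicalSpace X, t ≤ τ ∧ @PolishSpace X t ∧ IsOpen[t] S ∧ IsOpen[t] Sᶜ ∧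
      ∀ U, IsOpen[t] U → IsSigma τ (η + 1) U := by
  -- Once `S` is open in a topology contained in `Σ⁰_η`, its complement can be declared open.
  have key : ∀ (η : Ordinal.{0}) (S : Set X) (t : TopologicalSpace X), 1 ≤ η → t ≤ τ →
      @PolishSpace X t → IsOpen[t] S → (∀ U, IsOpen[t] U → IsSigma τ η U) →
      ∃ t' : TopologicalSpace X, t' ≤ τ ∧ @PolishSpace X t' ∧ IsOpen[t'] S ∧ IsOpen[t'] Sᶜ ∧
        ∀ U, IsOpen[t'] U → IsSigma τ (η + 1) U := by
    intro η S t hη ht hP hS hU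
    obtain ⟨t', ht', hP', hF, hU'⟩ :=
      @BaireRank.exists_polish_isClopen X t hP Sᶜ (@IsOpen.isClosed_compl X t S hS)
    refine ⟨t', ht'.trans ht, hP', ht' _ hS, hF, fun U hUo => ?_⟩
    obtain ⟨V, W, hV, hW, rfl⟩ := hU' U hUo
    have hlt : η < η + 1 := lt_add_one η
    rw [compl_compl]
    exact (((hU V hV).mono hlt.le).inter ((hU S hS).compl_of_lt hlt)).union
      (((hU W hW).inter (hU S hS)).mono hlt.le)
  induction h with
  | isOpen s hs => exact key 1 s τ le_rfl le_rfl ‹_› hs fun U hU => isSigma_one.2 hU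
  | iUnion ξ hξ η hη A hA ih =>
    choose m hm hP _ hc hS using ih
    obtain ⟨t, ht, htm, hPt, hSt⟩ := exists_polish_le_forall_isSigma hξ.le m hm hP
      fun n U hU => (hS n U hU).mono (Order.add_one_le_of_lt (hη n).2)
    refine key ξ _ t hξ.le ht hPt ?_ hSt
    refine @isOpen_iUnion _ _ t _ fun n => htm n _ ?_
    simpa only [compl_compl] using hc n

/-- Countably many sets of class `Σ⁰_ξ` are open in a Polish refinement contained in `Σ⁰_ξ`. -/
theorem exists_polish_forall_isOpen {ξ : Ordinal.{0}} (hξ : 1 ≤ ξ) {ι : Type*} [Countable ι]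
    {S : ι → Set X} (h : ∀ i, IsSigma τ ξ (S i)) :
    ∃ t : TopologicalSpace X, t ≤ τ ∧ @PolishSpace X t ∧ (∀ i, IsOpen[t] (S i)) ∧
      ∀ U, IsOpen[t] U → IsSigma τ ξ U := by
  rcases hξ.eq_or_lt with rfl | h1
  · exact ⟨τ, le_rfl, ‹_›, fun i => (h i).isOpen_of_one, fun U hU => isSigma_one.2 hU⟩
  choose η A hη hA hS using fun i => (h i).exists_of_one_lt h1
  choose m hm hP _ hc hU using fun p : ι × ℕ => (hA p.1 p.2).exists_polish_isClopen
  obtain ⟨t, ht, htm, hPt, hSt⟩ := exists_polish_le_forall_isSigma hξ m hm hP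
    fun p U hU' => (hU p U hU').mono (Order.add_one_le_of_lt (hη _ _).2)
  refine ⟨t, ht, hPt, fun i => ?_, hSt⟩
  rw [hS]
  refine @isOpen_iUnion _ _ t _ fun n => htm (i, n) _ ?_
  simpa only [compl_compl] using hc (i, n)

end Refinement

/-! ### Characteristic functions of a given Baire class -/

section Indicator

variable {X : Type*}

theorem IsBaireClass.continuous_of_zero {τ : TopologicalSpace X} {f : X → ℝ}
    (h : IsBaireClass τ 0 f) : Continuous f := by
  generalize hξ : (0 : Ordinal.{0}) = ξ at h
  cases h with
  | continuous f hf => exact hf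
  | limit _ η hη => exact absurd (hξ ▸ hη 0) not_lt_zero

theorem IsBaireClass.exists_continuous {τ : TopologicalSpace X} {f : X → ℝ}
    (h : IsBaireClass τ 1 f) : ∃ F : ℕ → X → ℝ, (∀ n, Continuous (F n)) ∧
      ∀ x, Tendsto (fun n => F n x) atTop (𝓝 (f x)) := by
  generalize hξ : (1 : Ordinal.{0}) = ξ at h
  cases h with
  | continuous f hf => exact absurd hξ one_ne_zero
  | limit _ η hη F hF f hf =>
    refine ⟨F, fun n => ?_, hf⟩
    have h0 : η n = 0 := by
      have := hη n
      rw [← hξ] at this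
      exact Order.lt_one_iff.1 this
    exact IsBaireClass.continuous_of_zero (h0 ▸ hF n)

/-- If `A` and its complement are both `F_σ`, Urysohn's lemma provides continuous functions
converging to the characteristic function of `A`. -/
theorem isBaireClass_one_indicator [τ : TopologicalSpace X] [NormalSpace X] {A : Set X}
    {K L : ℕ → Set X} (hK : ∀ n, IsClosed (K n)) (hL : ∀ n, IsClosed (L n))
    (hA : A = ⋃ n, K n) (hA' : Aᶜ = ⋃ n, L n) :
    IsBaireClass τ 1 (A.indicator fun _ => (1 : ℝ)) := by
  have hdisj : ∀ n, Disjoint (partialSups L n) (partialSups K n) := by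
    intro n
    rw [partialSups_eq_accumulate, partialSups_eq_accumulate]
    refine Disjoint.mono (accumulate_subset_iUnion n) (accumulate_subset_iUnion n) ?_
    rw [← hA, ← hA']
    exact disjoint_compl_left
  have hcl : ∀ {S : ℕ → Set X}, (∀ n, IsClosed (S n)) → ∀ n, IsClosed (partialSups S n) := by
    intro S hS n
    rw [partialSups_eq_accumulate, accumulate_def]
    exact (finite_le_nat n).isClosed_biUnion fun i _ => hS i
  choose F hF0 hF1 _ using fun n =>
    exists_continuous_zero_one_of_isClosed (hcl hL n) (hcl hK n) (hdisj n)
  refine IsBaireClass.limit 1 (fun _ => 0) (fun _ => zero_lt_one) (fun n => F n)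
    (fun n => .continuous _ (F n).continuous) _ fun x => ?_
  have hev : ∀ {S : ℕ → Set X}, x ∈ ⋃ n, S n → ∀ᶠ n in atTop, x ∈ partialSups S n := by
    intro S hx
    obtain ⟨i, hi⟩ := mem_iUnion.1 hx
    exact (eventually_ge_atTop i).mono fun n hn => le_partialSups_of_le S hn hi
  refine tendsto_const_nhds.congr' ?_
  by_cases hx : x ∈ A
  · filter_upwards [hev (hA ▸ hx)] with n hn
    rw [indicator_of_mem hx, hF1 n hn, Pi.one_apply]
  · filter_upwards [hev (hA' ▸ hx : x ∈ ⋃ n, L n)] with n hn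
    rw [indicator_of_notMem hx, hF0 n hn, Pi.zero_apply]

/-- The ambiguous class `Δ⁰_ξ`. -/
def IsDelta (τ : TopologicalSpace X) (ξ : Ordinal.{0}) (S : Set X) : Prop :=
  IsSigma τ ξ S ∧ IsSigma τ ξ Sᶜ

theorem IsSigma.isDelta_of_lt {τ : TopologicalSpace X} [PolishSpace X]
    {η ξ : Ordinal.{0}} {S : Set X} (h : IsSigma τ η S) (hlt : η < ξ) :
    IsDelta τ ξ S :=
  ⟨h.mono hlt.le, h.compl_of_lt hlt⟩

theorem IsDelta.compl {τ : TopologicalSpace X}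
    {ξ : Ordinal.{0}} {S : Set X} (h : IsDelta τ ξ S) : IsDelta τ ξ Sᶜ :=
  ⟨h.2, by rw [compl_compl]; exact h.1⟩

theorem IsDelta.inter {τ : TopologicalSpace X} [PolishSpace X]
    {ξ : Ordinal.{0}} {S T : Set X} (hS : IsDelta τ ξ S)
    (hT : IsDelta τ ξ T) : IsDelta τ ξ (S ∩ T) :=
  ⟨hS.1.inter hT.1, by rw [compl_inter]; exact hS.2.union hT.2⟩

theorem IsDelta.biInter {τ : TopologicalSpace X} [PolishSpace X]
    {ι : Type*} [Countable ι] {ξ : Ordinal.{0}} (hξ : 1 ≤ ξ) (s : Finset ι)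
    {S : ι → Set X} (h : ∀ i ∈ s, IsDelta τ ξ (S i)) : IsDelta τ ξ (⋂ i ∈ s, S i) := by
  refine ⟨IsSigma.biInter_finset hξ s fun i hi => (h i hi).1, ?_⟩
  rw [compl_iInter₂]
  exact IsSigma.iUnion_countable hξ fun i => IsSigma.iUnion_countable hξ fun hi => (h i hi).2

theorem IsDelta.biUnion {τ : TopologicalSpace X} [PolishSpace X]
    {ι : Type*} [Countable ι] {ξ : Ordinal.{0}} (hξ : 1 ≤ ξ) (s : Finset ι)
    {S : ι → Set X} (h : ∀ i ∈ s, IsDelta τ ξ (S i)) : IsDelta τ ξ (⋃ i ∈ s, S i) := by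
  rw [← compl_compl (⋃ i ∈ s, S i), compl_iUnion₂]
  exact (IsDelta.biInter hξ s fun i hi => (h i hi).compl).compl

theorem IsSigma.exists_eq_iInter {τ : TopologicalSpace X}
    {ξ : Ordinal.{0}} (h1 : 1 < ξ) {K : ℕ → Set X}
    (hK : ∀ n, IsSigma τ ξ (K n)ᶜ) : ∃ (η : ℕ → ℕ → Ordinal.{0}) (B : ℕ → ℕ → Set X),
      (∀ n m, η n m < ξ) ∧ (∀ n m, IsSigma τ (η n m) (B n m)) ∧ ∀ n, K n = ⋂ m, B n m := by
  choose η B hη hB hS using fun n => (hK n).exists_of_one_lt h1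
  refine ⟨η, fun n m => (B n m)ᶜ, fun n m => (hη n m).2, hB, fun n => ?_⟩
  rw [← compl_compl (K n), hS n, compl_iUnion]

theorem IsSigma.exists_iUnion_of_add_one {τ : TopologicalSpace X} [PolishSpace X]
    {ξ : Ordinal.{0}} {S : Set X} (h : IsSigma τ (ξ + 1) S) (hξ : 1 ≤ ξ) :
    ∃ K : ℕ → Set X, (∀ n, IsSigma τ ξ (K n)ᶜ) ∧ S = ⋃ n, K n := by
  obtain ⟨η, K, hη, hK, hSK⟩ := h.exists_of_one_lt (hξ.trans_lt (lt_add_one _))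
  exact ⟨K, fun n => (hK n).mono (Order.lt_add_one_iff.1 (hη n).2), hSK⟩

/-- The characteristic function of a set that is, together with its complement, a countable union
of sets of class `Π⁰_ξ` is of Baire class `ξ`. -/
theorem isBaireClass_indicator {τ : TopologicalSpace X} [PolishSpace X]
    (ξ : Ordinal.{0}) (hξ : 1 ≤ ξ) {A : Set X} {K L : ℕ → Set X}
    (hK : ∀ n, IsSigma τ ξ (K n)ᶜ) (hL : ∀ n, IsSigma τ ξ (L n)ᶜ)
    (hA : A = ⋃ n, K n) (hA' : Aᶜ = ⋃ n, L n) :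
    IsBaireClass τ ξ (A.indicator fun _ => (1 : ℝ)) := by
  induction ξ using WellFoundedLT.induction generalizing A K L with
  | ind ξ ih =>
  rcases hξ.eq_or_lt with rfl | h1
  · exact isBaireClass_one_indicator (fun n => ⟨(hK n).isOpen_of_one⟩)
      (fun n => ⟨(hL n).isOpen_of_one⟩) hA hA'
  obtain ⟨η, B, hη, hB, hKB⟩ := IsSigma.exists_eq_iInter (K := K) h1 hK
  obtain ⟨θ, C, hθ, hC, hLC⟩ := IsSigma.exists_eq_iInter (K := L) h1 hL
  -- `x ∈ E m` when, judged by the first `m` factors only, `x` enters some `K n` before entering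
  -- any of `L 0, …, L (n - 1)`.
  let E : ℕ → Set X := fun m => ⋃ n ∈ Finset.range (m + 1),
    (⋂ j ∈ Finset.range (m + 1), B n j) ∩
      ⋂ k ∈ Finset.range n, (⋂ j ∈ Finset.range (m + 1), C k j)ᶜ
  let T : ℕ → Finset (ℕ × ℕ) := fun m => Finset.range (m + 1) ×ˢ Finset.range (m + 1)
  let ν : ℕ → Ordinal.{0} := fun m => (T m).sup fun p => max (η p.1 p.2) (θ p.1 p.2)
  have hν : ∀ m, ν m < ξ := fun m =>
    (Finset.sup_lt_iff (zero_lt_one.trans h1)).2 fun p _ => max_lt (hη _ _) (hθ _ _)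
  have hle : ∀ m n j, n < m + 1 → j < m + 1 → max (η n j) (θ n j) ≤ ν m := by
    intro m n j hn hj
    exact Finset.le_sup (f := fun p : ℕ × ℕ => max (η p.1 p.2) (θ p.1 p.2)) (b := (n, j))
      (Finset.mem_product.2 ⟨Finset.mem_range.2 hn, Finset.mem_range.2 hj⟩)
  have hν1 : ∀ m, 1 ≤ ν m := fun m => (hB 0 0).one_le.trans
    ((le_max_left _ _).trans (hle m 0 0 m.succ_pos m.succ_pos))
  have hE : ∀ m, IsDelta τ (ν m + 1) (E m) := by
    intro m
    have hlt : ν m < ν m + 1 := lt_add_one _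
    have h1' : 1 ≤ ν m + 1 := (hν1 m).trans hlt.le
    refine IsDelta.biUnion h1' _ fun n hn => ?_
    rw [Finset.mem_range] at hn
    refine (IsDelta.biInter h1' _ fun j hj => ?_).inter
      (IsDelta.biInter h1' _ fun k hk => (IsDelta.biInter h1' _ fun j hj => ?_).compl)
    · exact (hB n j).isDelta_of_lt
        (((le_max_left _ _).trans (hle m n j hn (Finset.mem_range.1 hj))).trans_lt hlt)
    · exact (hC k j).isDelta_of_lt (((le_max_right _ _).trans
        (hle m k j ((Finset.mem_range.1 hk).trans hn) (Finset.mem_range.1 hj))).trans_lt hlt)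
  refine IsBaireClass.limit ξ ν hν (fun m => (E m).indicator fun _ => (1 : ℝ)) (fun m => ?_) _
    fun x => ?_
  · obtain ⟨K', hK', hE'⟩ := (hE m).1.exists_iUnion_of_add_one (hν1 m)
    obtain ⟨L', hL', hE''⟩ := (hE m).2.exists_iUnion_of_add_one (hν1 m)
    exact ih (ν m) (hν m) (hν1 m) hK' hL' hE' hE''
  · have hfin : ∀ {D : ℕ → ℕ → Set X} {n : ℕ}, x ∉ ⋂ j, D n j →
        ∀ᶠ m in atTop, x ∉ ⋂ j ∈ Finset.range (m + 1), D n j := by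
      intro D n hx
      obtain ⟨j, hj⟩ := not_forall.1 (mt mem_iInter.2 hx)
      refine (eventually_ge_atTop j).mono fun m hm hmem => hj ?_
      exact mem_iInter₂.1 hmem j (Finset.mem_range.2 (Nat.lt_succ_of_le hm))
    refine tendsto_const_nhds.congr' ?_
    by_cases hx : x ∈ A
    · obtain ⟨n, hn⟩ := mem_iUnion.1 (hA ▸ hx)
      have hxL : ∀ k, x ∉ L k := fun k hk => (hA' ▸ mem_iUnion.2 ⟨k, hk⟩ : x ∈ Aᶜ) hx
      have hev : ∀ᶠ m in atTop, ∀ k ∈ Finset.range n,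
          x ∉ ⋂ j ∈ Finset.range (m + 1), C k j :=
        (Finset.eventually_all _).2 fun k _ => hfin (hLC k ▸ hxL k)
      filter_upwards [hev, eventually_ge_atTop n] with m hm hnm
      have hxE : x ∈ E m := by
        refine mem_iUnion₂.2 ⟨n, Finset.mem_range.2 (Nat.lt_succ_of_le hnm), ?_, mem_iInter₂.2 hm⟩
        rw [hKB n] at hn
        exact mem_iInter₂.2 fun j _ => mem_iInter.1 hn j
      rw [indicator_of_mem hx, indicator_of_mem hxE]
    · obtain ⟨n, hn⟩ := mem_iUnion.1 (hA' ▸ hx : x ∈ ⋃ n, L n)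
      have hxK : ∀ k, x ∉ K k := fun k hk => hx (hA ▸ mem_iUnion.2 ⟨k, hk⟩)
      have hev : ∀ᶠ m in atTop, ∀ k ∈ Finset.range (n + 1),
          x ∉ ⋂ j ∈ Finset.range (m + 1), B k j :=
        (Finset.eventually_all _).2 fun k _ => hfin (hKB k ▸ hxK k)
      filter_upwards [hev] with m hm
      have hxE : x ∉ E m := by
        intro hxE
        obtain ⟨k, -, hkB, hkC⟩ := mem_iUnion₂.1 hxE
        by_cases hkn : k < n + 1
        · exact hm k (Finset.mem_range.2 hkn) hkB
        · refine mem_iInter₂.1 hkC n (Finset.mem_range.2 (by omega)) ?_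
          rw [hLC n] at hn
          exact mem_iInter₂.2 fun j _ => mem_iInter.1 hn j
      rw [indicator_of_notMem hx, indicator_of_notMem hxE]

end Indicator

/-! ### Universal sets -/

section Universal

/-- The `n`-th of the countably many points of the Cantor space coded by a single one. -/
def slice (n : ℕ) (d : ℕ → Bool) : ℕ → Bool := fun m => d (Nat.pair n m)

theorem continuous_slice (n : ℕ) : Continuous (slice n) :=
  continuous_pi fun _ => continuous_apply _

theorem exists_slice_eq (d : ℕ → ℕ → Bool) : ∃ c, ∀ n, slice n c = d n :=
  ⟨fun k => d k.unpair.1 k.unpair.2, fun n => by ext m; simp [slice]⟩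

theorem countable_Iio_iff {o : Ordinal.{0}} : (Iio o).Countable ↔ o < ω₁ := by
  rw [← Cardinal.le_aleph0_iff_set_countable, Cardinal.mk_Iio_ordinal, Cardinal.lift_le_aleph0,
    ← Cardinal.lt_aleph_one_iff, Cardinal.lt_omega_iff_card_lt]

/-- Universal sets for `Σ⁰_ξ`: the sections `U d` run over all sets of class `Σ⁰_ξ`, and
substituting for `d` a continuous function of the point does not leave the class. Continuity is
only required on a closed set `C`, outside of which every point is accepted. -/
theorem exists_universal {X : Type*} {τ : TopologicalSpace X} [PolishSpace X] {C : Set X}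
    (hC : IsClosed C) (ξ : Ordinal.{0}) (hξ : 1 ≤ ξ) (hξ' : ξ < ω₁) :
    ∃ U : (ℕ → Bool) → Set X, (∀ S, IsSigma τ ξ S → ∃ d, U d = S) ∧
      ∀ s : X → ℕ → Bool, ContinuousOn s C → IsSigma τ ξ {x | x ∈ C → x ∈ U (s x)} := by
  classical
  induction ξ using WellFoundedLT.induction with
  | ind ξ ih =>
  rcases hξ.eq_or_lt with rfl | h1
  · obtain ⟨b, hb, -, hbas⟩ := TopologicalSpace.exists_countable_basis X
    obtain ⟨B, hB⟩ : ∃ B : ℕ → Set X, insert ∅ b = range B :=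
      (hb.insert ∅).exists_eq_range (insert_nonempty _ _)
    have hBo : ∀ n, IsOpen (B n) := by
      intro n
      rcases (hB ▸ mem_range_self n : B n ∈ insert ∅ b) with h | h
      · rw [h]; exact isOpen_empty
      · exact hbas.isOpen h
    refine ⟨fun d => ⋃ n, {x | d n = true ∧ x ∈ B n}, fun S hS => ?_, fun s hs => ?_⟩
    · refine ⟨fun n => decide (B n ⊆ S), ?_⟩
      ext x
      simp only [decide_eq_true_eq, mem_iUnion, mem_ofPred_eq]
      refine ⟨fun ⟨n, hn, hx⟩ => hn hx, fun hx => ?_⟩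
      obtain ⟨v, hv, hxv, hvS⟩ := hbas.exists_subset_of_mem_open hx hS.isOpen_of_one
      obtain ⟨n, rfl⟩ : v ∈ range B := hB ▸ mem_insert_of_mem _ hv
      exact ⟨n, hvS, hxv⟩
    · have hev : ∀ n, Continuous fun d : ℕ → Bool => d n := fun n => continuous_apply n
      have hO : ∀ n, ∃ O : Set X, IsOpen O ∧ {x | s x n = true} ∩ C = O ∩ C := fun n =>
        continuousOn_iff'.1 hs {d | d n = true}
          ((isOpen_discrete ({true} : Set Bool)).preimage (hev n))
      choose O hOo hOC using hO
      have heq : {x | x ∈ C → x ∈ ⋃ n, {x' | s x n = true ∧ x' ∈ B n}} =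
          Cᶜ ∪ ⋃ n, O n ∩ B n := by
        ext x
        by_cases hx : x ∈ C
        · have : ∀ n, s x n = true ↔ x ∈ O n := by
            intro n
            simpa [hx] using congrArg (fun S => x ∈ S) (hOC n)
          simp [hx, this]
        · simp [hx]
      rw [heq, isSigma_one]
      exact hC.isOpen_compl.union (isOpen_iUnion fun n => (hOo n).inter (hBo n))
  · -- Each class below `ξ` is allotted infinitely many slices of the code.
    obtain ⟨e, he⟩ : ∃ e : ℕ → Ordinal.{0}, Ico 1 ξ = range e :=
      ((countable_Iio_iff.2 hξ').mono Ico_subset_Iio_self).exists_eq_range ⟨1, le_rfl, h1⟩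
    have hemem : ∀ i, e i ∈ Ico 1 ξ := fun i => he ▸ mem_range_self i
    choose U hU hUs using fun i => ih (e i) (hemem i).2 (hemem i).1 ((hemem i).2.trans hξ')
    refine ⟨fun d => ⋃ k : ℕ, (U k.unpair.1 (slice k d))ᶜ, fun S hS => ?_, fun s hs => ?_⟩
    · obtain ⟨η, A, hη, hA, rfl⟩ := hS.exists_of_one_lt h1
      have hd : ∀ k : ℕ, ∃ d, U k.unpair.1 d =
          if e k.unpair.1 = η k.unpair.2 then (A k.unpair.2)ᶜ else univ := by
        intro k
        split_ifs with h
        · exact hU _ _ (h ▸ hA _)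
        · exact hU _ _ (IsSigma.of_isOpen (hemem _).1 isOpen_univ)
      choose d hd using hd
      obtain ⟨c, hc⟩ := exists_slice_eq d
      refine ⟨c, ?_⟩
      ext x
      simp only [hc, hd, mem_iUnion]
      constructor
      · rintro ⟨k, hk⟩
        split_ifs at hk with h
        · exact ⟨k.unpair.2, by simpa using hk⟩
        · simp at hk
      · rintro ⟨j, hj⟩
        obtain ⟨i, hi⟩ : η j ∈ range e := he ▸ hη j
        exact ⟨Nat.pair i j, by simpa [hi] using hj⟩
    · have heq : {x | x ∈ C → x ∈ ⋃ k : ℕ, (U k.unpair.1 (slice k (s x)))ᶜ} =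
          Cᶜ ∪ ⋃ k : ℕ, {x | x ∈ C → x ∈ U k.unpair.1 (slice k (s x))}ᶜ := by
        ext x
        by_cases hx : x ∈ C <;> simp [hx]
      rw [heq]
      refine (IsSigma.of_isOpen hξ hC.isOpen_compl).union (IsSigma.iUnion_nat fun k => ?_)
      exact (hUs k.unpair.1 _ ((continuous_slice k).comp_continuousOn hs)).compl_of_lt (hemem _).2

end Universal

/-! ### Iterated derivatives -/

section Deriv

variable {X : Type*} {D D' : Set X → Set X}

theorem iterDeriv_zero (F : Set X) : iterDeriv D F 0 = F :=
  limitRecOn_zero _ _ _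

theorem iterDeriv_add_one (F : Set X) (η : Ordinal.{0}) :
    iterDeriv D F (η + 1) = D (iterDeriv D F η) :=
  limitRecOn_add_one _ _ _ _

theorem iterDeriv_limit (F : Set X) {η : Ordinal.{0}} (h : Order.IsSuccLimit η) :
    iterDeriv D F η = ⋂ (θ : Ordinal.{0}) (_ : θ < η), iterDeriv D F θ :=
  limitRecOn_limit _ _ _ _ h

theorem rk_le {η : Ordinal.{0}} (h : iterDeriv D univ η = ∅) : rk D ≤ η := by
  have h' : ∃ η, iterDeriv D univ η = ∅ := ⟨η, h⟩
  rw [rk, if_pos h']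
  exact csInf_le' h

theorem iterDeriv_rk (h : ∃ η, iterDeriv D univ η = ∅) : iterDeriv D univ (rk D) = ∅ := by
  rw [rk, if_pos h]
  exact csInf_mem h

theorem iterDeriv_rk_of_lt (h : rk D < ω₁) : iterDeriv D univ (rk D) = ∅ := by
  refine iterDeriv_rk ?_
  by_contra h'
  rw [rk, if_neg h'] at h
  exact h.false

variable {τ : TopologicalSpace X}

theorem isClosed_iterDeriv (hD : ∀ F, IsClosed F → IsClosed (D F)) (η : Ordinal.{0}) :
    IsClosed (iterDeriv D univ η) := by
  induction η using Ordinal.limitRecOn with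
  | zero => rw [iterDeriv_zero]; exact isClosed_univ
  | add_one η ih => rw [iterDeriv_add_one]; exact hD _ ih
  | limit η h ih => rw [iterDeriv_limit _ h]; exact isClosed_biInter ih

theorem iterDeriv_antitone (hD : ∀ F, IsClosed F → IsClosed (D F))
    (hsub : ∀ F, IsClosed F → D F ⊆ F) : Antitone (iterDeriv D univ) := by
  intro θ η h
  induction η using Ordinal.limitRecOn with
  | zero => rw [nonpos_iff_eq_zero.1 h]
  | add_one η ih =>
    rcases h.eq_or_lt with rfl | h
    · exact le_rfl
    · rw [iterDeriv_add_one]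
      exact (hsub _ (isClosed_iterDeriv hD η)).trans (ih (Order.lt_add_one_iff.1 h))
  | limit η hl ih =>
    rcases h.eq_or_lt with rfl | h
    · exact le_rfl
    · rw [iterDeriv_limit _ hl]
      exact biInter_subset_of_mem h

theorem iterDeriv_subset (hD : ∀ F, IsClosed F → IsClosed (D F))
    (hsub : ∀ F, IsClosed F → D F ⊆ D' F) (hmono : Monotone D') (η : Ordinal.{0}) :
    iterDeriv D univ η ⊆ iterDeriv D' univ η := by
  induction η using Ordinal.limitRecOn with
  | zero => rw [iterDeriv_zero, iterDeriv_zero]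
  | add_one η ih =>
    rw [iterDeriv_add_one, iterDeriv_add_one]
    exact (hsub _ (isClosed_iterDeriv hD η)).trans (hmono ih)
  | limit η h ih =>
    rw [iterDeriv_limit _ h, iterDeriv_limit _ h]
    exact iInter₂_mono ih

theorem rk_le_rk (h : ∀ η, iterDeriv D univ η ⊆ iterDeriv D' univ η)
    (h' : ∃ η, iterDeriv D' univ η = ∅) : rk D ≤ rk D' :=
  rk_le (subset_empty_iff.1 ((h _).trans (iterDeriv_rk h').subset))

/-- In a second countable space a derivative that shrinks every non-empty closed set
vanishes at a countable stage, since a strictly decreasing transfinite sequence of closed sets is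
countable. -/
theorem exists_iterDeriv_eq_empty [SecondCountableTopology X]
    (hD : ∀ F, IsClosed F → IsClosed (D F)) (hsub : ∀ F, IsClosed F → D F ⊆ F)
    (hne : ∀ F, IsClosed F → F.Nonempty → D F ≠ F) :
    ∃ η < ω₁, iterDeriv D univ η = ∅ := by
  by_contra! hcon
  obtain ⟨b, hb, -, hbas⟩ := TopologicalSpace.exists_countable_basis X
  have hpt : ∀ η : Iio (ω₁ : Ordinal.{0}), ∃ x ∈ iterDeriv D univ η.1, ∃ v ∈ b, x ∈ v ∧
      v ⊆ (iterDeriv D univ (η.1 + 1))ᶜ := by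
    rintro ⟨η, hη⟩
    have hcl := isClosed_iterDeriv hD η
    have hss : iterDeriv D univ (η + 1) ⊂ iterDeriv D univ η := by
      rw [iterDeriv_add_one]
      exact (hsub _ hcl).ssubset_of_ne (hne _ hcl (hcon η hη))
    obtain ⟨x, hx, hx'⟩ := exists_of_ssubset hss
    obtain ⟨v, hv, hxv, hvs⟩ := hbas.exists_subset_of_mem_open (a := x) hx'
      (isClosed_iterDeriv hD _).isOpen_compl
    exact ⟨x, hx, v, hv, hxv, hvs⟩
  choose x hx v hv hxv hvs using hpt
  have hlt : ∀ η θ, η < θ → v η ≠ v θ := by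
    intro η θ h heq
    refine hvs η (heq ▸ hxv θ) ?_
    exact iterDeriv_antitone hD hsub (Order.add_one_le_of_lt (show η.1 < θ.1 from h)) (hx θ)
  have hinj : Function.Injective fun η => (⟨v η, hv η⟩ : b) := by
    intro η θ h
    by_contra hne
    rcases lt_or_gt_of_ne hne with h' | h'
    · exact hlt _ _ h' (congrArg Subtype.val h)
    · exact hlt _ _ h' (congrArg Subtype.val h).symm
  have : Countable b := hb.to_subtype
  have hc : (Iio (ω₁ : Ordinal.{0})).Countable := hinj.countable
  exact (countable_Iio_iff.1 hc).false

end Deriv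

/-! ### Comparison of the three ranks -/

section Ranks

variable {X : Type*} {τ : TopologicalSpace X} {f : X → ℝ} {F : ℕ → X → ℝ}

theorem exists_of_seqOsc_lt {x : X} {S : Set X} {e : ENNReal} (h : seqOsc τ F x S < e) :
    ∃ U, IsOpen U ∧ x ∈ U ∧ ∃ N : ℕ, ∃ c < e, ∀ n ≥ N, ∀ m ≥ N, ∀ y ∈ U ∩ S,
      ENNReal.ofReal |F m y - F n y| ≤ c := by
  simp only [seqOsc, iInf_lt_iff] at h
  obtain ⟨U, hU, hx, N, h⟩ := h
  refine ⟨U, hU, hx, N, _, h, fun n hn m hm y hy => ?_⟩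
  exact le_iSup₂_of_le n hn (le_iSup₂_of_le m hm (le_iSup₂_of_le y hy le_rfl))

theorem seqOsc_le {x : X} {S U : Set X} {c : ENNReal} (hU : IsOpen U) (hx : x ∈ U) (N : ℕ)
    (h : ∀ n ≥ N, ∀ m ≥ N, ∀ y ∈ U ∩ S, ENNReal.ofReal |F m y - F n y| ≤ c) :
    seqOsc τ F x S ≤ c :=
  iInf₂_le_of_le U hU <| iInf₂_le_of_le hx N <| iSup₂_le fun n hn => iSup₂_le fun m hm =>
    iSup₂_le fun y hy => h n hn m hm y hy

theorem seqDeriv_subset (ε : ℝ) (S : Set X) : seqDeriv τ F ε S ⊆ S := fun _ h => h.1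

theorem isClosed_seqDeriv (ε : ℝ) {S : Set X} (hS : IsClosed S) :
    IsClosed (seqDeriv τ F ε S) := by
  refine hS.inter (s₂ := {x | ENNReal.ofReal ε ≤ seqOsc τ F x S}) ⟨isOpen_iff_mem_nhds.2 ?_⟩
  intro x hx
  obtain ⟨U, hU, hxU, N, c, hc, h⟩ := exists_of_seqOsc_lt (not_le.1 hx)
  filter_upwards [hU.mem_nhds hxU] with y hy
  exact not_le.2 ((seqOsc_le hU hy N h).trans_lt hc)

theorem seqDeriv_mono (ε : ℝ) : Monotone (seqDeriv τ F ε) := by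
  refine fun S T h x hx => ⟨h hx.1, le_of_not_gt fun hlt => hx.2.not_gt ?_⟩
  obtain ⟨U, hU, hxU, N, c, hc, hle⟩ := exists_of_seqOsc_lt hlt
  exact (seqOsc_le hU hxU N fun n hn m hm y hy =>
    hle n hn m hm y (inter_subset_inter_right U h hy)).trans_lt hc

/-- The Baire category theorem, applied to a closed set `S`, gives an open piece of `S` on which
the convergence is uniform up to `ε / 2`. -/
theorem seqDeriv_ne [PolishSpace X] (hF : ∀ n, Continuous (F n))
    (hf : ∀ x, Tendsto (fun n => F n x) atTop (𝓝 (f x))) {ε : ℝ} (hε : 0 < ε) {S : Set X}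
    (hS : IsClosed S) (hne : S.Nonempty) : seqDeriv τ F ε S ≠ S := by
  have : PolishSpace S := hS.polishSpace
  have : Nonempty S := hne.to_subtype
  let E : ℕ → Set S := fun N => ⋂ (n : ℕ) (_ : N ≤ n) (m : ℕ) (_ : N ≤ m),
    {y : S | |F m y - F n y| ≤ ε / 2}
  have hE : ∀ N, IsClosed (E N) := fun N =>
    isClosed_biInter fun n _ => isClosed_biInter fun m _ => isClosed_le
      ((((hF m).comp continuous_subtype_val).sub ((hF n).comp continuous_subtype_val)).abs)
      continuous_const
  have hU : ⋃ N, E N = Set.univ := by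
    refine eq_univ_of_forall fun y => mem_iUnion.2 ?_
    obtain ⟨N, hN⟩ := Metric.cauchySeq_iff.1 (hf y).cauchySeq (ε / 2) (half_pos hε)
    refine ⟨N, mem_iInter₂.2 fun n hn => mem_iInter₂.2 fun m hm => ?_⟩
    exact (hN m hm n hn).le
  let _ := TopologicalSpace.upgradeIsCompletelyMetrizable S
  obtain ⟨N, y, hy⟩ := nonempty_interior_of_iUnion_of_closed hE hU
  obtain ⟨V, hV, hVE⟩ := isOpen_induced_iff.1 (isOpen_interior (s := E N))
  intro heq
  have hyV : y.1 ∈ V := by rw [← hVE] at hy; exact hy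
  have h1 : ENNReal.ofReal ε ≤ seqOsc τ F y S := (heq.symm.subset y.2).2
  have h2 : seqOsc τ F y S ≤ ENNReal.ofReal (ε / 2) := by
    refine seqOsc_le hV hyV N fun n hn m hm z hz => ENNReal.ofReal_le_ofReal ?_
    have hzE : (⟨z, hz.2⟩ : S) ∈ E N := interior_subset (hVE.subset hz.1)
    exact mem_iInter₂.1 (mem_iInter₂.1 hzE n hn) m hm
  have h3 := (ENNReal.ofReal_le_ofReal_iff (half_pos hε).le).1 (h1.trans h2)
  linarith

theorem exists_iterDeriv_seqDeriv_eq_empty [PolishSpace X] (hF : ∀ n, Continuous (F n))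
    (hf : ∀ x, Tendsto (fun n => F n x) atTop (𝓝 (f x))) {ε : ℝ} (hε : 0 < ε) :
    ∃ η < ω₁, iterDeriv (seqDeriv τ F ε) univ η = ∅ :=
  exists_iterDeriv_eq_empty (fun _ hS => isClosed_seqDeriv ε hS)
    (fun S _ => seqDeriv_subset ε S) fun _ hS hne => seqDeriv_ne hF hf hε hS hne

theorem rk_seqDeriv_anti [PolishSpace X] (hF : ∀ n, Continuous (F n))
    (hf : ∀ x, Tendsto (fun n => F n x) atTop (𝓝 (f x))) {δ ε : ℝ} (hδ : 0 < δ) (h : δ ≤ ε) :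
    rk (seqDeriv τ F ε) ≤ rk (seqDeriv τ F δ) := by
  obtain ⟨η, -, hη⟩ := exists_iterDeriv_seqDeriv_eq_empty (τ := τ) hF hf hδ
  refine rk_le_rk (iterDeriv_subset (fun _ hS => isClosed_seqDeriv ε hS) (fun S _ x hx => ?_)
    (seqDeriv_mono δ)) ⟨η, hη⟩
  exact ⟨hx.1, (ENNReal.ofReal_le_ofReal h).trans hx.2⟩

theorem iSup_rk_seqDeriv_lt [PolishSpace X] (hF : ∀ n, Continuous (F n))
    (hf : ∀ x, Tendsto (fun n => F n x) atTop (𝓝 (f x))) :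
    ⨆ ε : {ε : ℝ // 0 < ε}, rk (seqDeriv τ F ε.1) < ω₁ := by
  have hn : ∀ n : ℕ, rk (seqDeriv τ F (1 / (n + 1 : ℝ))) < ω₁ := fun n => by
    obtain ⟨η, hη, h⟩ := exists_iterDeriv_seqDeriv_eq_empty (τ := τ) hF hf
      (Nat.one_div_pos_of_nat (α := ℝ) (n := n))
    exact (rk_le h).trans_lt hη
  refine lt_of_le_of_lt (Ordinal.iSup_le fun ε => ?_) (Ordinal.iSup_lt_omega_one hn)
  obtain ⟨n, hn'⟩ := exists_nat_one_div_lt ε.2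
  exact (rk_seqDeriv_anti hF hf Nat.one_div_pos_of_nat hn'.le).trans
    (Ordinal.le_iSup (fun n : ℕ => rk (seqDeriv τ F (1 / (n + 1 : ℝ)))) n)

theorem oscDeriv_mono (ε : ℝ) : Monotone (oscDeriv τ f ε) := by
  refine fun S T h x hx => ⟨h hx.1, hx.2.trans ?_⟩
  refine iInf_mono fun U => iInf₂_mono fun _ _ => ?_
  have hUS : U ∩ S ⊆ U ∩ T := inter_subset_inter_right U h
  exact iSup₂_le fun y hy => iSup₂_le fun z hz =>
    le_iSup₂_of_le y (hUS hy) (le_iSup₂_of_le z (hUS hz) le_rfl)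

theorem isClosed_oscDeriv (ε : ℝ) {S : Set X} (hS : IsClosed S) :
    IsClosed (oscDeriv τ f ε S) := by
  refine hS.inter (s₂ := {x | ENNReal.ofReal ε ≤ osc τ f x S}) ⟨isOpen_iff_mem_nhds.2 ?_⟩
  intro x hx
  have hlt : osc τ f x S < ENNReal.ofReal ε := not_le.1 hx
  simp only [osc, iInf_lt_iff] at hlt
  obtain ⟨U, hU, hxU, h⟩ := hlt
  filter_upwards [hU.mem_nhds hxU] with y hy
  exact not_le.2 ((iInf_le_of_le U (iInf₂_le hU hy)).trans_lt h)

theorem isClosed_sepDeriv (A B S : Set X) : IsClosed (sepDeriv τ A B S) :=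
  isClosed_closure.inter isClosed_closure

theorem sepDeriv_subset_oscDeriv {p q : ℝ} {S : Set X} (hS : IsClosed S) :
    sepDeriv τ {x | f x ≤ p} {x | q ≤ f x} S ⊆ oscDeriv τ f (q - p) S := by
  intro x hx
  refine ⟨hS.closure_subset_iff.2 inter_subset_left hx.1, ?_⟩
  refine le_iInf fun U => le_iInf₂ fun hU hxU => ?_
  obtain ⟨y, hyU, hyS, hyp⟩ := mem_closure_iff.1 hx.1 U hU hxU
  obtain ⟨z, hzU, hzS, hzq⟩ := mem_closure_iff.1 hx.2 U hU hxU
  refine le_iSup₂_of_le z ⟨hzU, hzS⟩ (le_iSup₂_of_le y ⟨hyU, hyS⟩ ?_)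
  refine ENNReal.ofReal_le_ofReal (le_trans ?_ (le_abs_self _))
  have hyp' : f y ≤ p := hyp
  have hzq' : q ≤ f z := hzq
  linarith

theorem oscDeriv_subset_seqDeriv (hF : ∀ n, Continuous (F n))
    (hf : ∀ x, Tendsto (fun n => F n x) atTop (𝓝 (f x))) {ε : ℝ} (hε : 0 < ε) (S : Set X) :
    oscDeriv τ f ε S ⊆ seqDeriv τ F (ε / 4) S := by
  refine fun x hx => ⟨hx.1, le_of_not_gt fun hlt => hx.2.not_gt ?_⟩
  obtain ⟨U, hU, hxU, N, c, hc, hle⟩ := exists_of_seqOsc_lt hlt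
  have h1 : ∀ y ∈ U ∩ S, |f y - F N y| ≤ ε / 4 := by
    intro y hy
    refine le_of_tendsto ((hf y).sub_const (F N y)).abs
      ((eventually_ge_atTop N).mono fun m hm => ?_)
    exact (ENNReal.ofReal_le_ofReal_iff (by positivity)).1 ((hle N le_rfl m hm y hy).trans hc.le)
  let V := F N ⁻¹' Metric.ball (F N x) (ε / 16)
  have hV : IsOpen V := Metric.isOpen_ball.preimage (hF N)
  have hxV : x ∈ V := Metric.mem_ball_self (by positivity)
  refine lt_of_le_of_lt (iInf_le_of_le (U ∩ V) (iInf₂_le_of_le (hU.inter hV) ⟨hxU, hxV⟩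
    (iSup₂_le fun y hy => iSup₂_le fun z hz => ?_)))
    ((ENNReal.ofReal_lt_ofReal_iff hε).2 (by linarith : 5 * ε / 8 < ε))
  refine ENNReal.ofReal_le_ofReal ?_
  have hy1 := abs_le.1 (h1 y ⟨hy.1.1, hy.2⟩)
  have hz1 := abs_le.1 (h1 z ⟨hz.1.1, hz.2⟩)
  have hy2 : |F N y - F N x| < ε / 16 := hy.1.2
  have hz2 : |F N z - F N x| < ε / 16 := hz.1.2
  rw [abs_lt] at hy2 hz2
  rw [abs_le]
  constructor <;> linarith

theorem exists_gammaRank_eq (hf : IsBaireClass τ 1 f) :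
    ∃ F : ℕ → X → ℝ, (∀ n, Continuous (F n)) ∧
      (∀ x, Tendsto (fun n => F n x) atTop (𝓝 (f x))) ∧
      gammaRank τ f = ⨆ ε : {ε : ℝ // 0 < ε}, rk (seqDeriv τ F ε.1) := by
  obtain ⟨F, hF, hlim⟩ := hf.exists_continuous
  exact csInf_mem (s := {ρ | ∃ F : ℕ → X → ℝ, (∀ n, Continuous (F n)) ∧
    (∀ x, Tendsto (fun n => F n x) atTop (𝓝 (f x))) ∧
    ρ = ⨆ ε : {ε : ℝ // 0 < ε}, rk (seqDeriv τ F ε.1)}) ⟨_, F, hF, hlim, rfl⟩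

theorem gammaRank_lt [PolishSpace X] (hf : IsBaireClass τ 1 f) : gammaRank τ f < ω₁ := by
  obtain ⟨F, hF, hlim, h⟩ := exists_gammaRank_eq hf
  exact h ▸ iSup_rk_seqDeriv_lt hF hlim

theorem iterDeriv_oscDeriv_subset (hF : ∀ n, Continuous (F n))
    (hf : ∀ x, Tendsto (fun n => F n x) atTop (𝓝 (f x))) {ε : ℝ} (hε : 0 < ε) (η : Ordinal.{0}) :
    iterDeriv (oscDeriv τ f ε) univ η ⊆ iterDeriv (seqDeriv τ F (ε / 4)) univ η :=
  iterDeriv_subset (fun _ hS => isClosed_oscDeriv ε hS)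
    (fun S _ => oscDeriv_subset_seqDeriv hF hf hε S) (seqDeriv_mono _) η

theorem betaRank_le_gammaRank [PolishSpace X] (hf : IsBaireClass τ 1 f) :
    betaRank τ f ≤ gammaRank τ f := by
  obtain ⟨F, hF, hlim, h⟩ := exists_gammaRank_eq hf
  rw [h]
  refine Ordinal.iSup_le fun ε => ?_
  have hε : 0 < ε.1 / 4 := by have := ε.2; positivity
  obtain ⟨η, -, hη⟩ := exists_iterDeriv_seqDeriv_eq_empty (τ := τ) hF hlim hε
  exact (rk_le_rk (iterDeriv_oscDeriv_subset hF hlim ε.2) ⟨η, hη⟩).trans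
    (Ordinal.le_iSup (fun ε : {ε : ℝ // 0 < ε} => rk (seqDeriv τ F ε.1)) ⟨ε.1 / 4, hε⟩)

theorem alphaRank_le_betaRank [PolishSpace X] (hf : IsBaireClass τ 1 f) :
    alphaRank τ f ≤ betaRank τ f := by
  obtain ⟨F, hF, hlim⟩ := hf.exists_continuous
  refine Ordinal.iSup_le fun r => ?_
  have hr : (0 : ℝ) < r.1.2 - r.1.1 := sub_pos.2 (by exact_mod_cast r.2)
  obtain ⟨η, -, hη⟩ := exists_iterDeriv_seqDeriv_eq_empty (τ := τ) hF hlim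
    (show (0 : ℝ) < (r.1.2 - r.1.1) / 4 by positivity)
  refine (rk_le_rk (iterDeriv_subset (fun _ _ => isClosed_sepDeriv _ _ _)
    (fun S hS => sepDeriv_subset_oscDeriv hS) (oscDeriv_mono _)) ⟨η, ?_⟩).trans
    (Ordinal.le_iSup (fun ε : {ε : ℝ // 0 < ε} => rk (oscDeriv τ f ε.1)) ⟨_, hr⟩)
  exact subset_empty_iff.1 ((iterDeriv_oscDeriv_subset hF hlim hr η).trans hη.subset)

end Ranks

/-! ### Transfinite differences and diagonalization -/

section Diagonal

variable {X : Type*}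

/-- A transfinite difference of the pairs `V η true, V η false`, `η < ζ`: a point `x` belongs to it
if, at the first `η` where `x` leaves one of the two sets, it leaves only `V η false`. -/
def transDiff (ζ : Ordinal.{0}) (V : Ordinal.{0} → Bool → Set X) : Set X :=
  {x | ∃ η < ζ, (∀ θ < η, ∀ b, x ∈ V θ b) ∧ x ∈ V η true ∧ x ∉ V η false}

theorem compl_transDiff (ζ : Ordinal.{0}) (V : Ordinal.{0} → Bool → Set X) :
    (transDiff ζ V)ᶜ = {x | ∀ η < ζ, ∀ b, x ∈ V η b} ∪
      {x | ∃ η < ζ, (∀ θ < η, ∀ b, x ∈ V θ b) ∧ x ∉ V η true} := by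
  ext x
  constructor
  · intro hx
    by_cases hall : ∀ η < ζ, ∀ b, x ∈ V η b
    · exact Or.inl hall
    right
    push Not at hall
    obtain ⟨η, ⟨hη, b, hb⟩, hmin⟩ := WellFounded.has_min (wellFounded_lt (α := Ordinal.{0}))
      {η | η < ζ ∧ ∃ b, x ∉ V η b} hall
    have hlow : ∀ θ < η, ∀ b, x ∈ V θ b := fun θ hθ b => by
      by_contra h
      exact hmin θ ⟨hθ.trans hη, b, h⟩ hθ
    refine ⟨η, hη, hlow, fun ht => hx ⟨η, hη, hlow, ht, ?_⟩⟩
    cases b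
    exacts [hb, absurd ht hb]
  · rintro (hx | ⟨η, hη, hlow, ht⟩) ⟨θ, hθ, hlow', ht', hf'⟩
    · exact hf' (hx θ hθ false)
    · rcases lt_trichotomy η θ with h | rfl | h
      · exact ht (hlow' η h true)
      · exact ht ht'
      · exact hf' (hlow θ h false)

/-- A transfinite difference of countable length of closed sets is `F_σ`, and so is its
complement. -/
theorem isDelta_transDiff {τ : TopologicalSpace X} [PolishSpace X] {ζ : Ordinal.{0}} (hζ : ζ < ω₁)
    {V : Ordinal.{0} → Bool → Set X} (hV : ∀ η b, IsClosed (V η b)) :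
    IsDelta τ (1 + 1) (transDiff ζ V) := by
  have : Countable (Iio ζ) := (countable_Iio_iff.2 hζ).to_subtype
  have h1 : (1 : Ordinal.{0}) < 1 + 1 := lt_add_one 1
  have hcl : ∀ {S : Set X}, IsClosed S → IsSigma τ (1 + 1) S := fun hS => by
    simpa using (isSigma_one.2 hS.isOpen_compl).compl_of_lt h1
  have hlow : ∀ η, IsClosed {x | ∀ θ < η, ∀ b, x ∈ V θ b} := fun η => by
    simp only [ofPred_forall]
    exact isClosed_iInter fun θ => isClosed_iInter fun _ => isClosed_iInter fun b => hV θ b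
  have hunion : ∀ S : Ordinal.{0} → Set X, (∀ η, IsSigma τ (1 + 1) (S η)) →
      IsSigma τ (1 + 1) {x | ∃ η < ζ, x ∈ S η} := fun S hS => by
    have : {x | ∃ η < ζ, x ∈ S η} = ⋃ η : Iio ζ, S η := by ext; simp
    rw [this]
    exact IsSigma.iUnion_countable h1.le fun η => hS η
  constructor
  · exact hunion (fun η => {x | ∀ θ < η, ∀ b, x ∈ V θ b} ∩ (V η true ∩ (V η false)ᶜ)) fun η =>
      (hcl (hlow η)).inter ((hcl (hV _ _)).inter (IsSigma.of_isOpen h1.le (hV _ _).isOpen_compl))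
  · rw [compl_transDiff]
    exact (hcl (hlow ζ)).union
      (hunion (fun η => {x | ∀ θ < η, ∀ b, x ∈ V θ b} ∩ (V η true)ᶜ) fun η =>
        (hcl (hlow η)).inter (IsSigma.of_isOpen h1.le (hV _ _).isOpen_compl))

/-- If the separation rank of the characteristic function of `A` is less than `ζ`, then the
complement of `A` is a transfinite difference of length `ζ` of closed sets, namely of the closures
of the traces of `Aᶜ` and of `A` on the iterated derivatives. -/
theorem exists_compl_eq_transDiff {τ : TopologicalSpace X} {A : Set X} {ζ : Ordinal.{0}}
    (hζ : ζ < ω₁) (h : alphaRank τ (A.indicator fun _ => (1 : ℝ)) < ζ) :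
    ∃ G : Ordinal.{0} → Bool → Set X, (∀ η b, IsClosed (G η b)) ∧ Aᶜ = transDiff ζ G := by
  have hle : rk (sepDeriv τ Aᶜ A) < ζ := by
    refine lt_of_le_of_lt ?_ h
    have := Ordinal.le_iSup (fun r : {r : ℚ × ℚ // r.1 < r.2} =>
      rk (sepDeriv τ {x | A.indicator (fun _ => (1 : ℝ)) x ≤ (r.1.1 : ℝ)}
        {x | (r.1.2 : ℝ) ≤ A.indicator (fun _ => (1 : ℝ)) x})) ⟨(0, 1), zero_lt_one⟩
    have h0 : {x | A.indicator (fun _ => (1 : ℝ)) x ≤ ((0 : ℚ) : ℝ)} = Aᶜ := by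
      ext x
      by_cases hx : x ∈ A <;> simp [hx]
    have h1 : {x | ((1 : ℚ) : ℝ) ≤ A.indicator (fun _ => (1 : ℝ)) x} = A := by
      ext x
      by_cases hx : x ∈ A <;> simp [hx]
    simp only [h0, h1] at this
    exact this
  set F := iterDeriv (sepDeriv τ Aᶜ A) Set.univ with hF
  let G : Ordinal.{0} → Bool → Set X := fun η b =>
    closure (F η ∩ bif b then Aᶜ else A)
  have hmem : ∀ x η, (∀ θ < η, ∀ b, x ∈ G θ b) → x ∈ F η := by
    intro x η
    induction η using Ordinal.limitRecOn with
    | zero => intro _; rw [hF, iterDeriv_zero]; trivial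
    | add_one η _ =>
      intro h
      rw [hF, iterDeriv_add_one]
      exact ⟨h η (lt_add_one η) true, h η (lt_add_one η) false⟩
    | limit η hl ih =>
      intro h
      rw [hF, iterDeriv_limit _ hl]
      exact mem_iInter₂.2 fun θ hθ => ih θ hθ fun θ' hθ' => h θ' (hθ'.trans hθ)
  refine ⟨G, fun η b => isClosed_closure, Subset.antisymm (fun x hx => ?_) ?_⟩
  · by_contra hcon
    rw [← mem_compl_iff, compl_transDiff] at hcon
    rcases hcon with hall | ⟨η, -, hlow, ht⟩
    · have := hmem x _ fun θ hθ => hall θ (hθ.trans hle)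
      rw [hF, iterDeriv_rk_of_lt (hle.trans hζ)] at this
      exact this
    · exact ht (subset_closure ⟨hmem x η hlow, hx⟩)
  · rintro x ⟨η, -, hlow, -, hf⟩ hA
    exact hf (subset_closure ⟨hmem x η hlow, hA⟩)

/-- The diagonal argument: inside a perfect set there is a set, of class `Δ⁰_{ξ+1}`, whose
complement is not a transfinite difference of length `ζ` of sets of class `Π⁰_ξ`. -/
theorem exists_indicator_le_alphaRank [τ : TopologicalSpace X] [PolishSpace X] {ξ : Ordinal.{0}}
    (hξ : 1 ≤ ξ) (hξ' : ξ < ω₁) {P : Set X} (hP : Perfect P) (hne : P.Nonempty)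
    {ζ : Ordinal.{0}} (hζ : ζ < ω₁) :
    ∃ A ⊆ P, IsBaireClass τ ξ (A.indicator fun _ => (1 : ℝ)) ∧
      (refinements τ ξ (A.indicator fun _ => (1 : ℝ))).Nonempty ∧
      ∀ τ' ∈ refinements τ ξ (A.indicator fun _ => (1 : ℝ)),
        ζ ≤ alphaRank τ' (A.indicator fun _ => (1 : ℝ)) := by
  obtain ⟨φ, hφP, hφ, hφinj⟩ : ∃ φ : (ℕ → Bool) → X, range φ ⊆ P ∧ Continuous φ ∧
      Function.Injective φ := by
    let _ := TopologicalSpace.upgradeIsCompletelyMetrizable X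
    exact hP.exists_nat_bool_injection hne
  have hemb := hφ.isClosedEmbedding hφinj
  let s : X → ℕ → Bool := Function.invFun φ
  have hsφ : ∀ c, s (φ c) = c := Function.leftInverse_invFun hφinj
  have hs : ContinuousOn s (range φ) := by
    rw [hemb.isEmbedding.continuousOn_iff]
    refine continuousOn_id.congr ?_
    rintro _ ⟨c, rfl⟩
    exact congrArg φ (hsφ c)
  obtain ⟨U, hU, hUs⟩ := exists_universal (τ := τ) hemb.isClosed_range ξ hξ hξ'
  obtain ⟨e, he⟩ := countable_iff_exists_injOn.1
    ((countable_Iio_iff.2 hζ).prod (countable_univ (α := Bool)))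
  -- The code of `x = φ c` is `c`, and its slices code a sequence of `Π⁰_ξ` sets of length `ζ`;
  -- `V η b` consists of the points belonging to the set of index `(η, b)` that they code.
  let Q : ℕ → Set X := fun k => {x | x ∈ range φ → x ∈ U (slice k (s x))}
  let V : Ordinal.{0} → Bool → Set X := fun η b => (Q (e (η, b)))ᶜ
  have hQ : ∀ k, IsSigma τ ξ (Q k) := fun k =>
    hUs _ ((continuous_slice k).comp_continuousOn hs)
  obtain ⟨τ₀, hle, hP₀, hopen, hsig⟩ := exists_polish_forall_isOpen hξ hQ
  have hΔ : IsDelta τ₀ (1 + 1) (transDiff ζ V) :=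
    @isDelta_transDiff X τ₀ hP₀ ζ hζ V fun η b => ⟨by rw [compl_compl]; exact hopen _⟩
  obtain ⟨K, hK, hAK⟩ := hΔ.1.exists_iUnion_of_add_one le_rfl
  obtain ⟨L, hL, hAL⟩ := hΔ.2.exists_iUnion_of_add_one le_rfl
  refine ⟨transDiff ζ V, ?_, ?_, ⟨τ₀, hle, hP₀, hsig, ?_⟩, ?_⟩
  · rintro x ⟨η, -, -, hx, -⟩
    exact hφP (Classical.not_imp.1 hx).1
  · exact isBaireClass_indicator ξ hξ (fun n => hsig _ (hK n).isOpen_of_one)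
      (fun n => hsig _ (hL n).isOpen_of_one) hAK hAL
  · exact @isBaireClass_indicator X τ₀ hP₀ 1 le_rfl _ K L hK hL hAK hAL
  · rintro τ' ⟨-, -, hsub, -⟩
    by_contra! hlt
    obtain ⟨G, hG, hGA⟩ := exists_compl_eq_transDiff hζ hlt
    choose d hd using fun p : Ordinal.{0} × Bool => hU _ (hsub _ (hG p.1 p.2).isOpen_compl)
    obtain ⟨c, hc⟩ := exists_slice_eq fun k => d (Function.invFunOn e (Iio ζ ×ˢ Set.univ) k)
    have hVG : ∀ η < ζ, ∀ b, φ c ∈ V η b ↔ φ c ∈ G η b := by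
      intro η hη b
      have hcode : U (slice (e (η, b)) c) = (G η b)ᶜ := by
        rw [hc, he.leftInvOn_invFunOn (show (η, b) ∈ Iio ζ ×ˢ Set.univ from ⟨hη, trivial⟩), hd]
      simp [V, Q, hsφ, hcode]
    -- So `φ c` belongs to the difference of the sets `V η b` if and only if it belongs to that of
    -- the sets `G η b`, which is the complement of the former.
    have hiff : φ c ∈ transDiff ζ V ↔ φ c ∈ transDiff ζ G := by
      refine exists_congr fun η => and_congr_right fun hη => and_congr ?_ (and_congr
        (hVG η hη true) (not_congr (hVG η hη false)))
      exact forall₂_congr fun θ hθ => forall_congr' fun b => hVG θ (hθ.trans hη) b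
    rw [← hGA, mem_compl_iff] at hiff
    exact iff_not_self hiff

theorem starRank_mem_Ico {ρ : TopologicalSpace X → (X → ℝ) → Ordinal.{0}} {τ : TopologicalSpace X}
    {ξ ζ : Ordinal.{0}} {f : X → ℝ} (hne : (refinements τ ξ f).Nonempty)
    (hle : ∀ τ' ∈ refinements τ ξ f, ζ ≤ ρ τ' f) (hlt : ∀ τ' ∈ refinements τ ξ f, ρ τ' f < ω₁) :
    ζ ≤ starRank ρ τ ξ f ∧ starRank ρ τ ξ f < ω₁ := by
  obtain ⟨τ', hτ', h⟩ := csInf_mem (hne.image fun τ' => ρ τ' f)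
  rw [starRank, ← h]
  exact ⟨hle τ' hτ', hlt τ' hτ'⟩

end Diagonal

end BaireRank

theorem mainTheorem2 {X : Type*} [τ : TopologicalSpace X] [PolishSpace X] [Uncountable X]
    (ξ : Ordinal.{0}) (hξ : 1 ≤ ξ) (hξ' : ξ < ω₁) :
    ((∀ ζ : Ordinal.{0}, ζ < ω₁ → ∃ f : X → ℝ, BaireRank.IsBaireClass τ ξ f ∧
        ζ ≤ BaireRank.starRank BaireRank.alphaRank τ ξ f ∧
        BaireRank.starRank BaireRank.alphaRank τ ξ f < ω₁) ∧
      (∀ ζ : Ordinal.{0}, ζ < ω₁ → ∃ f : X → ℝ, BaireRank.IsBaireClass τ ξ f ∧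
        ζ ≤ BaireRank.starRank BaireRank.betaRank τ ξ f ∧
        BaireRank.starRank BaireRank.betaRank τ ξ f < ω₁) ∧
      (∀ ζ : Ordinal.{0}, ζ < ω₁ → ∃ f : X → ℝ, BaireRank.IsBaireClass τ ξ f ∧
        ζ ≤ BaireRank.starRank BaireRank.gammaRank τ ξ f ∧
        BaireRank.starRank BaireRank.gammaRank τ ξ f < ω₁)) ∧
    ∀ P : Set X, Perfect P → P.Nonempty → ∀ ζ : Ordinal.{0}, ζ < ω₁ →
      ∃ A : Set X, A ⊆ P ∧
        BaireRank.IsBaireClass τ ξ (A.indicator fun _ => (1 : ℝ)) ∧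
        (ζ ≤ BaireRank.starRank BaireRank.alphaRank τ ξ (A.indicator fun _ => (1 : ℝ)) ∧
          BaireRank.starRank BaireRank.alphaRank τ ξ (A.indicator fun _ => (1 : ℝ)) < ω₁) ∧
        (ζ ≤ BaireRank.starRank BaireRank.betaRank τ ξ (A.indicator fun _ => (1 : ℝ)) ∧
          BaireRank.starRank BaireRank.betaRank τ ξ (A.indicator fun _ => (1 : ℝ)) < ω₁) ∧
        (ζ ≤ BaireRank.starRank BaireRank.gammaRank τ ξ (A.indicator fun _ => (1 : ℝ)) ∧
          BaireRank.starRank BaireRank.gammaRank τ ξ (A.indicator fun _ => (1 : ℝ)) < ω₁) := by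
  have key : ∀ P : Set X, Perfect P → P.Nonempty → ∀ ζ : Ordinal.{0}, ζ < ω₁ →
      ∃ A : Set X, A ⊆ P ∧
        BaireRank.IsBaireClass τ ξ (A.indicator fun _ => (1 : ℝ)) ∧
        (ζ ≤ BaireRank.starRank BaireRank.alphaRank τ ξ (A.indicator fun _ => (1 : ℝ)) ∧
          BaireRank.starRank BaireRank.alphaRank τ ξ (A.indicator fun _ => (1 : ℝ)) < ω₁) ∧
        (ζ ≤ BaireRank.starRank BaireRank.betaRank τ ξ (A.indicator fun _ => (1 : ℝ)) ∧
          BaireRank.starRank BaireRank.betaRank τ ξ (A.indicator fun _ => (1 : ℝ)) < ω₁) ∧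
        (ζ ≤ BaireRank.starRank BaireRank.gammaRank τ ξ (A.indicator fun _ => (1 : ℝ)) ∧
          BaireRank.starRank BaireRank.gammaRank τ ξ (A.indicator fun _ => (1 : ℝ)) < ω₁) := by
    intro P hP hne ζ hζ
    obtain ⟨A, hAP, hA, hT, hα⟩ := BaireRank.exists_indicator_le_alphaRank hξ hξ' hP hne hζ
    have hαβ : ∀ τ' ∈ BaireRank.refinements τ ξ (A.indicator fun _ => (1 : ℝ)), _ :=
      fun τ' h => @BaireRank.alphaRank_le_betaRank X τ' _ h.2.1 h.2.2.2
    have hβγ : ∀ τ' ∈ BaireRank.refinements τ ξ (A.indicator fun _ => (1 : ℝ)), _ :=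
      fun τ' h => @BaireRank.betaRank_le_gammaRank X τ' _ h.2.1 h.2.2.2
    have hγ : ∀ τ' ∈ BaireRank.refinements τ ξ (A.indicator fun _ => (1 : ℝ)), _ :=
      fun τ' h => @BaireRank.gammaRank_lt X τ' _ h.2.1 h.2.2.2
    exact ⟨A, hAP, hA,
      BaireRank.starRank_mem_Ico hT hα
        fun τ' h => (hαβ τ' h).trans_lt ((hβγ τ' h).trans_lt (hγ τ' h)),
      BaireRank.starRank_mem_Ico hT (fun τ' h => (hα τ' h).trans (hαβ τ' h))
        fun τ' h => (hβγ τ' h).trans_lt (hγ τ' h),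
      BaireRank.starRank_mem_Ico hT
        (fun τ' h => (hα τ' h).trans ((hαβ τ' h).trans (hβγ τ' h))) hγ⟩
  obtain ⟨P, hP, hne, -⟩ := exists_perfect_nonempty_of_isClosed_of_not_countable
    (isClosed_univ (X := X)) not_countable_univ
  refine ⟨⟨fun ζ hζ => ?_, fun ζ hζ => ?_, fun ζ hζ => ?_⟩, key⟩
  · obtain ⟨A, -, hA, h, -, -⟩ := key P hP hne ζ hζ
    exact ⟨_, hA, h⟩
  · obtain ⟨A, -, hA, -, h, -⟩ := key P hP hne ζ hζ
    exact ⟨_, hA, h⟩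
  · obtain ⟨A, -, hA, -, -, h⟩ := key P hP hne ζ hζ
    exact ⟨_, hA, h⟩
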